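/- Let $p_x,p_y\ge 0$ be integers and $p=p_x+p_y$. Let $\mathbb{P}$ be a Gaussian distribution on $\mathbb{R}^{p_x}\times\mathbb{R}^{p_y}=\mathbb{R}^{p}$ with mean $\mu$ and positive semidefinite covariance $\Sigma$. Let $\underline{x}\le\overline{x}$ be real numbers, $\Delta=(\overline{x}-\underline{x})p_x$, $\epsilon>0$ and $0<\delta\le 1.25$ (so that $\log(1.25/\delta)\ge 0$), and let $\mathbb{W}$ be the distribution on $\mathbb{R}^{p_x}$ of a vector of i.i.d. zero-mean Gaussian coordinates with standard deviation $\sigma=\sqrt{2\log(1.25/\delta)}\,\Delta/\epsilon$. Let $(x_i,y_i,w_i)$, $i=1,2,\dots$, be i.i.d., where $(x_i,y_i)\sim\mathbb{P}$ and $w_i\sim\mathbb{W}$ is independent of $(x_i,y_i)$, and put $\tilde{x}_i=x_i+w_i$, $\tilde{y}_i=y_i$, $\tilde{z}_i=(\tilde{x}_i,\tilde{y}_i)$. Let $\widehat{\mathbb{D}}_n$ be the Gaussian distribution on $\mathbb{R}^p$ with mean $\widehat{\mu}_n$ and covariance $\widehat{\Sigma}_n$, where $$\widehat{\mu}_n=\frac1n\sum_{i=1}^n\tilde{z}_i,\qquad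 \widehat{\Sigma}_n=\frac{1}{n-1}\sum_{i=1}^n(\tilde{z}_i-\widehat{\mu}_n)(\tilde{z}_i-\widehat{\mu}_n)^\top .$$ Let $\mathfrak{W}_2(\mathbb{P}_1,\mathbb{P}_2)=\inf_{\Pi}\big[\int\|\xi_1-\xi_2\|^2\,\Pi(\mathrm{d}\xi_1,\mathrm{d}\xi_2)\big]^{1/2}$, where $\|\cdot\|$ is the Euclidean norm and the infimum is over all joint distributions $\Pi$ with marginals $\mathbb{P}_1$ and $\mathbb{P}_2$. Then, almost surely, for every $\varepsilon>0$ there exists $n_\varepsilon\ge 0$ such that for all $n\ge n_\varepsilon$, $$\mathfrak{W}_2(\widehat{\mathbb{D}}_n,\mathbb{P})\le \varepsilon+\frac{\sqrt{2\log(1.25/\delta)\,p}\;\Delta}{\epsilon}.$$ -/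

import Mathlib

open MeasureTheory ProbabilityTheory
open scoped ENNReal

namespace DPGaussian

/-- Records `(x, y)` with input `x ∈ ℝ^px` and output `y ∈ ℝ^py`, stacked into one vector of
`ℝ^(px + py)` with the Euclidean norm. -/
abbrev Record (px py : ℕ) : Type := EuclideanSpace ℝ (Fin px ⊕ Fin py)

section Wasserstein

variable {E : Type*} [MeasurableSpace E]

/-- `π` is a joint distribution with marginals `P` and `Q`. -/
def IsCoupling (π : Measure (E × E)) (P Q : Measure E) : Prop :=
  π.fst = P ∧ π.snd = Q

/-- The Wasserstein distance of order `q`: the infimum over all couplings `π` of `P` and `Q` of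
`(∫ ‖ξ₁ - ξ₂‖ ^ q dπ) ^ (1 / q)`. It takes values in `[0, ∞]`. -/
noncomputable def wasserstein [NormedAddCommGroup E] (q : ℝ) (P Q : Measure E) : ℝ≥0∞ :=
  ⨅ (π : Measure (E × E)) (_ : IsCoupling π P Q),
    (∫⁻ z, ‖z.1 - z.2‖ₑ ^ q ∂π) ^ (1 / q)

end Wasserstein

/-- The sensitivity `Δ = (xhi - xlo) * px` of the inputs. -/
noncomputable def sensitivity (px : ℕ) (xlo xhi : ℝ) : ℝ := (xhi - xlo) * px

/-- The standard deviation `σ = √(2 log (1.25 / δ)) Δ / ε` of the Gaussian mechanism, where `ε` and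
`δ` are the privacy parameters. -/
noncomputable def noiseStd (Δ ε δ : ℝ) : ℝ := √(2 * Real.log (1.25 / δ)) * Δ / ε

/-- The law on `ℝ^px` of a vector of i.i.d. centred Gaussian coordinates of standard
deviation `σ`. -/
noncomputable def noiseLaw (px : ℕ) (σ : ℝ) : Measure (EuclideanSpace ℝ (Fin px)) :=
  (Measure.pi fun _ : Fin px ↦ gaussianReal 0 (σ ^ 2).toNNReal).map (WithLp.toLp 2)

/-- The reporting mechanism: the noise is added to the input `x` only, the output `y` is left
unchanged. -/
noncomputable def privatize {px py : ℕ} (ξ : Record px py) (w : EuclideanSpace ℝ (Fin px)) :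
    Record px py :=
  WithLp.toLp 2 (Sum.elim (fun i ↦ ξ (Sum.inl i) + w i) (fun j ↦ ξ (Sum.inr j)))

section Empirical

variable {ι : Type*}

/-- The mean of the first `n` samples. -/
noncomputable def sampleMean (z : ℕ → EuclideanSpace ℝ ι) (n : ℕ) : EuclideanSpace ℝ ι :=
  (1 / (n : ℝ)) • ∑ i ∈ Finset.range n, z i

/-- The (unbiased) covariance matrix of the first `n` samples, with normalisation
`1 / (n - 1)`. -/
noncomputable def sampleCov (z : ℕ → EuclideanSpace ℝ ι) (n : ℕ) : Matrix ι ι ℝ :=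
  (1 / ((n : ℝ) - 1)) • ∑ i ∈ Finset.range n,
    Matrix.vecMulVec (z i - sampleMean z n) (z i - sampleMean z n)

/-- The sample covariance is positive semidefinite, so that it is the covariance of a Gaussian. -/
theorem sampleCov_posSemidef [Fintype ι] (z : ℕ → EuclideanSpace ℝ ι) (n : ℕ) :
    (sampleCov z n).PosSemidef := by
  rcases n with _ | n
  · simpa [sampleCov] using Matrix.PosSemidef.zero
  · refine Matrix.PosSemidef.smul (Matrix.posSemidef_sum _ fun i _ ↦ ?_) (by simp)
    simpa using Matrix.posSemidef_vecMulVec_self_star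
      (WithLp.ofLp (z i - sampleMean z (n + 1)))

/-- The empirical distribution of the first `n` samples, taken to be the Gaussian distribution whose
mean and covariance are the sample mean and the sample covariance. -/
noncomputable def empiricalGaussian [Fintype ι] [DecidableEq ι]
    (z : ℕ → EuclideanSpace ℝ ι) (n : ℕ) : Measure (EuclideanSpace ℝ ι) :=
  multivariateGaussian (sampleMean z n) (sampleCov z n)

end Empirical

end DPGaussian

/-! The reported records have mean `m` and covariance `S + diagonal (noiseVar px py σ)`, and by the
strong law the sample moments converge to these almost surely. It remains to bound the distance
between two Gaussians by their moments. Driving both by one standard Gaussian `g`, through `m₁ + √A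
g` and `m₂ + √B g`, gives a coupling of cost `‖m₁ - m₂‖ ^ 2 + ∑ λᵢ ^ 2`, with `λᵢ` the eigenvalues
of `√A - √B`. Each `λᵢ ^ 2` is at most the spectral norm of `A - B` (`sq_eigenvalue_sub_le`), so no
continuity of the matrix square root is needed. In the limit `A - B` is the noise covariance, of
norm at most `σ ^ 2`, and the cost is at most `p σ ^ 2`. -/

namespace DPGaussian
open Filter Topology Matrix
open scoped RealInnerProductSpace


/-! ### Wasserstein bound between Gaussians. -/

variable {ι : Type*} [Fintype ι] [DecidableEq ι]

/-- If `v` is a unit eigenvector of `P - Q` with `P`, `Q` positive semidefinite, then the square of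
its eigenvalue is controlled by the quadratic form of `P * P - Q * Q` at `v`. -/
lemma sq_eigenvalue_sub_le {P Q : Matrix ι ι ℝ} (hP : P.PosSemidef) (hQ : Q.PosSemidef)
    {v : ι → ℝ} (hv : v ⬝ᵥ v = 1) {l : ℝ} (hl : (P - Q) *ᵥ v = l • v) :
    l ^ 2 ≤ |v ⬝ᵥ ((P * P - Q * Q) *ᵥ v)| := by
  have hp : 0 ≤ v ⬝ᵥ (P *ᵥ v) := by simpa using hP.dotProduct_mulVec_nonneg v
  have hq : 0 ≤ v ⬝ᵥ (Q *ᵥ v) := by simpa using hQ.dotProduct_mulVec_nonneg v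
  have hT : (P - Q)ᵀ = P - Q := by
    have h := (hP.isHermitian.sub hQ.isHermitian).eq
    rwa [conjTranspose_eq_transpose_of_trivial] at h
  have hl' : v ᵥ* (P - Q) = l • v := by rw [← mulVec_transpose, hT, hl]
  have h1 : v ⬝ᵥ (P *ᵥ v) - v ⬝ᵥ (Q *ᵥ v) = l := by
    rw [← dotProduct_sub, ← sub_mulVec, hl, dotProduct_smul, hv, smul_eq_mul, mul_one]
  have h2 : v ⬝ᵥ ((P * P - Q * Q) *ᵥ v) = l * (v ⬝ᵥ (P *ᵥ v) + v ⬝ᵥ (Q *ᵥ v)) := by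
    -- By symmetry `v` is also a left eigenvector of `P - Q`, so each summand yields a factor `l`.
    have : P * P - Q * Q = P * (P - Q) + (P - Q) * Q := by noncomm_ring
    rw [this, add_mulVec, dotProduct_add, ← mulVec_mulVec, hl, ← mulVec_mulVec,
      dotProduct_mulVec v (P - Q), hl', mulVec_smul, dotProduct_smul, smul_dotProduct]
    simp only [smul_eq_mul]
    ring
  rw [h2, abs_mul, ← sq_abs, sq]
  refine mul_le_mul_of_nonneg_left ?_ (abs_nonneg l)
  -- A difference of two nonnegative numbers is at most their sum in absolute value.
  rw [abs_of_nonneg (add_nonneg hp hq), ← h1, abs_le]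
  constructor <;> linarith

omit [DecidableEq ι] in
/-- The second moment of a Gaussian coordinate with an affine shift. -/
lemma integral_const_add_mul_inner_sq (a c : ℝ) (u : EuclideanSpace ℝ ι) (hu : ‖u‖ = 1) :
    Integrable (fun g ↦ (a + c * ⟪u, g⟫) ^ 2) (stdGaussian (EuclideanSpace ℝ ι)) ∧
    ∫ g, (a + c * ⟪u, g⟫) ^ 2 ∂stdGaussian (EuclideanSpace ℝ ι) = a ^ 2 + c ^ 2 := by
  have hm : MemLp (fun g ↦ ⟪u, g⟫) 2 (stdGaussian (EuclideanSpace ℝ ι)) :=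
    (innerSL ℝ u).comp_memLp' IsGaussian.memLp_two_id
  have h1 : ∫ g, ⟪u, g⟫ ∂stdGaussian (EuclideanSpace ℝ ι) = 0 :=
    integral_strongDual_stdGaussian (innerSL ℝ u)
  have h2 : ∫ g, ⟪u, g⟫ ^ 2 ∂stdGaussian (EuclideanSpace ℝ ι) = 1 := by
    have h := variance_dual_stdGaussian (innerSL ℝ u)
    rw [innerSL_apply_norm, hu, variance_of_integral_eq_zero (by fun_prop)
      (integral_strongDual_stdGaussian _)] at h
    simpa using h
  have hi1 := (hm.integrable one_le_two).const_mul (2 * a * c)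
  have hi2 := hm.integrable_sq.const_mul (c ^ 2)
  have he : (fun g ↦ (a + c * ⟪u, g⟫) ^ 2) =
      fun g ↦ a ^ 2 + 2 * a * c * ⟪u, g⟫ + c ^ 2 * ⟪u, g⟫ ^ 2 := by
    ext g; ring
  rw [he]
  refine ⟨((integrable_const _).add hi1).add hi2, ?_⟩
  have hi0 := (integrable_const (μ := stdGaussian (EuclideanSpace ℝ ι)) (a ^ 2)).add hi1
  simp only [Pi.add_def] at hi0
  rw [integral_add hi0 hi2, integral_add (integrable_const _) hi1, integral_const_mul, integral_const_mul, h1, h2]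
  simp

/-- The second moment of the affine image of a standard Gaussian under a symmetric matrix. -/
lemma lintegral_enorm_const_add_sq (a : EuclideanSpace ℝ ι) {D : Matrix ι ι ℝ}
    (hD : D.IsHermitian) :
    ∫⁻ g, ‖a + toEuclideanCLM (𝕜 := ℝ) D g‖ₑ ^ (2 : ℝ) ∂stdGaussian (EuclideanSpace ℝ ι) =
      ENNReal.ofReal (‖a‖ ^ 2 + ∑ i, hD.eigenvalues i ^ 2) := by
  -- In an orthonormal eigenbasis of `D` the squared norm splits into one-dimensional terms.
  set b := hD.eigenvectorBasis
  have hb (i : ι) : toEuclideanCLM (𝕜 := ℝ) D (b i) = hD.eigenvalues i • b i := by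
    apply WithLp.ofLp_injective 2
    simpa using hD.mulVec_eigenvectorBasis i
  have hs : IsSelfAdjoint (toEuclideanCLM (𝕜 := ℝ) D) := IsSelfAdjoint.map hD _
  have hin (i : ι) (g : EuclideanSpace ℝ ι) :
      ⟪b i, a + toEuclideanCLM (𝕜 := ℝ) D g⟫ = ⟪b i, a⟫ + hD.eigenvalues i * ⟪b i, g⟫ := by
    rw [inner_add_right, ← ContinuousLinearMap.adjoint_inner_left, hs.adjoint_eq, hb,
      real_inner_smul_left]
  have he (g : EuclideanSpace ℝ ι) : ‖a + toEuclideanCLM (𝕜 := ℝ) D g‖ₑ ^ (2 : ℝ) =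
      ENNReal.ofReal (∑ i, (⟪b i, a⟫ + hD.eigenvalues i * ⟪b i, g⟫) ^ 2) := by
    simp_rw [← hin]
    rw [b.sum_sq_inner_right, ENNReal.ofReal_pow (norm_nonneg _), ofReal_norm]
    norm_cast
  have hu (i : ι) := integral_const_add_mul_inner_sq ⟪b i, a⟫ (hD.eigenvalues i) (b i)
    (b.orthonormal.1 i)
  simp_rw [he]
  rw [← ofReal_integral_eq_lintegral_ofReal (integrable_finsetSum _ fun i _ ↦ (hu i).1)
    (ae_of_all _ fun g ↦ Finset.sum_nonneg fun i _ ↦ sq_nonneg _),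
    integral_finsetSum _ fun i _ ↦ (hu i).1]
  simp_rw [fun i ↦ (hu i).2]
  rw [Finset.sum_add_distrib, b.sum_sq_inner_right]

open scoped MatrixOrder in
/-- Two Gaussian distributions on `ℝ^ι` whose covariance matrices differ by at most `κ` in spectral
norm are close in the Wasserstein distance of order two. -/
theorem wasserstein_two_multivariateGaussian_le (m₁ m₂ : EuclideanSpace ℝ ι) {A B : Matrix ι ι ℝ}
    (hA : A.PosSemidef) (hB : B.PosSemidef) {κ : ℝ}
    (hκ : ∀ v : ι → ℝ, v ⬝ᵥ v = 1 → |v ⬝ᵥ ((A - B) *ᵥ v)| ≤ κ) :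
    wasserstein 2 (multivariateGaussian m₁ A) (multivariateGaussian m₂ B) ≤
      ENNReal.ofReal √(‖m₁ - m₂‖ ^ 2 + Fintype.card ι * κ) := by
  have hP : (CFC.sqrt A).PosSemidef := (CFC.sqrt_nonneg A).posSemidef
  have hQ : (CFC.sqrt B).PosSemidef := (CFC.sqrt_nonneg B).posSemidef
  have hD := hP.isHermitian.sub hQ.isHermitian
  have hf : Measurable fun g ↦ m₁ + toEuclideanCLM (𝕜 := ℝ) (CFC.sqrt A) g := by fun_prop
  have hg : Measurable fun g ↦ m₂ + toEuclideanCLM (𝕜 := ℝ) (CFC.sqrt B) g := by fun_prop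
  -- Sharing the same `g` makes the difference of the two components affine in `g`, with linear part
  -- `√A - √B`.
  set π := (stdGaussian (EuclideanSpace ℝ ι)).map fun g ↦
    (m₁ + toEuclideanCLM (𝕜 := ℝ) (CFC.sqrt A) g, m₂ + toEuclideanCLM (𝕜 := ℝ) (CFC.sqrt B) g)
    with hπ
  have hc : IsCoupling π (multivariateGaussian m₁ A) (multivariateGaussian m₂ B) :=
    ⟨Measure.fst_map_prodMk hg, Measure.snd_map_prodMk hf⟩
  refine (iInf₂_le π hc).trans ?_
  have hcost : ∫⁻ z, ‖z.1 - z.2‖ₑ ^ (2 : ℝ) ∂π =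
      ENNReal.ofReal (‖m₁ - m₂‖ ^ 2 + ∑ i, hD.eigenvalues i ^ 2) := by
    rw [hπ, lintegral_map (by fun_prop) (hf.prodMk hg), ← lintegral_enorm_const_add_sq]
    refine lintegral_congr fun g ↦ ?_
    rw [map_sub, _root_.sub_apply, add_sub_add_comm]
  have hle : ∑ i, hD.eigenvalues i ^ 2 ≤ Fintype.card ι * κ := by
    rw [← nsmul_eq_mul, ← Finset.card_univ]
    refine Finset.sum_le_card_nsmul _ _ _ fun i _ ↦ ?_
    have hv : (hD.eigenvectorBasis i : ι → ℝ) ⬝ᵥ (hD.eigenvectorBasis i : ι → ℝ) = 1 := by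
      simpa only [EuclideanSpace.inner_eq_star_dotProduct, star_trivial] using
        hD.eigenvectorBasis.inner_eq_one i
    have h := sq_eigenvalue_sub_le hP hQ hv (hD.mulVec_eigenvectorBasis i)
    rw [CFC.sqrt_mul_sqrt_self _ hA.nonneg, CFC.sqrt_mul_sqrt_self _ hB.nonneg] at h
    exact h.trans (hκ _ hv)
  rw [hcost, ENNReal.ofReal_rpow_of_nonneg (by positivity) (by norm_num), ← Real.sqrt_eq_rpow]
  gcongr

/-- Bound of a quadratic form at a unit vector by the entries, after removing a diagonal part. -/
lemma abs_dotProduct_mulVec_le {M : Matrix ι ι ℝ} {d : ι → ℝ} {c : ℝ}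
    (hd : ∀ i, 0 ≤ d i) (hdc : ∀ i, d i ≤ c) {v : ι → ℝ} (hv : v ⬝ᵥ v = 1) :
    |v ⬝ᵥ (M *ᵥ v)| ≤ c + ∑ j, ∑ k, |(M - diagonal d) j k| := by
  have hle (j : ι) : |v j| ≤ 1 := by
    rw [← sq_le_one_iff_abs_le_one, ← hv, sq]
    exact Finset.single_le_sum (f := fun i ↦ v i * v i) (fun i _ ↦ mul_self_nonneg _)
      (Finset.mem_univ j)
  have h1 : |v ⬝ᵥ ((M - diagonal d) *ᵥ v)| ≤ ∑ j, ∑ k, |(M - diagonal d) j k| := by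
    simp_rw [dotProduct, mulVec, dotProduct, Finset.mul_sum]
    refine (Finset.abs_sum_le_sum_abs _ _).trans (Finset.sum_le_sum fun j _ ↦
      (Finset.abs_sum_le_sum_abs _ _).trans (Finset.sum_le_sum fun k _ ↦ ?_))
    rw [abs_mul, abs_mul]
    calc _ ≤ 1 * (|(M - diagonal d) j k| * 1) := by gcongr <;> exact hle _
      _ = _ := by ring
  have h2 : |v ⬝ᵥ (diagonal d *ᵥ v)| ≤ c := by
    have h : v ⬝ᵥ (diagonal d *ᵥ v) = ∑ i, d i * (v i * v i) := by
      simp_rw [dotProduct, mulVec_diagonal]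
      exact Finset.sum_congr rfl fun i _ ↦ by ring
    rw [h, abs_of_nonneg (Finset.sum_nonneg fun i _ ↦ mul_nonneg (hd i) (mul_self_nonneg _))]
    calc _ ≤ ∑ i, c * (v i * v i) :=
          Finset.sum_le_sum fun i _ ↦ mul_le_mul_of_nonneg_right (hdc i) (mul_self_nonneg _)
      _ = c := by rw [← Finset.mul_sum]; exact (congrArg (c * ·) hv).trans (mul_one c)
  have h3 : v ⬝ᵥ (M *ᵥ v) = v ⬝ᵥ (diagonal d *ᵥ v) + v ⬝ᵥ ((M - diagonal d) *ᵥ v) := by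
    rw [← dotProduct_add, ← add_mulVec, add_sub_cancel]
  rw [h3]
  exact (abs_add_le _ _).trans (add_le_add h2 h1)

/-! ### Sample moments and the deterministic limit. -/

omit [Fintype ι] [DecidableEq ι] in
lemma sampleMean_apply (z : ℕ → EuclideanSpace ℝ ι) (n : ℕ) (j : ι) :
    sampleMean z n j = (∑ i ∈ Finset.range n, z i j) / n := by
  simp [sampleMean, div_eq_inv_mul]

-- Rewrites the centred sum as a difference of averages, to which the strong law applies. For `n =
-- 1` both sides vanish, since division by zero gives zero.
omit [Fintype ι] [DecidableEq ι] in
lemma sampleCov_apply (z : ℕ → EuclideanSpace ℝ ι) {n : ℕ} (hn : n ≠ 0) (j k : ι) :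
    sampleCov z n j k = (n / ((n : ℝ) - 1)) *
      ((∑ i ∈ Finset.range n, z i j * z i k) / n - sampleMean z n j * sampleMean z n k) := by
  have hn' : (n : ℝ) ≠ 0 := Nat.cast_ne_zero.2 hn
  have hj : ∑ i ∈ Finset.range n, z i j = n * sampleMean z n j := by
    rw [sampleMean_apply]; field_simp
  have hk : ∑ i ∈ Finset.range n, z i k = n * sampleMean z n k := by
    rw [sampleMean_apply]; field_simp
  have h : ∑ i ∈ Finset.range n, (z i j - sampleMean z n j) * (z i k - sampleMean z n k) =
      ∑ i ∈ Finset.range n, z i j * z i k - n * (sampleMean z n j * sampleMean z n k) := by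
    simp_rw [sub_mul, mul_sub, Finset.sum_sub_distrib, ← Finset.sum_mul, ← Finset.mul_sum, hj, hk]
    simp
    ring
  simp only [sampleCov, Matrix.smul_apply, Matrix.sum_apply, vecMulVec_apply, PiLp.sub_apply, h,
    smul_eq_mul]
  field_simp

omit [Fintype ι] [DecidableEq ι] in
lemma tendsto_sampleCov {z : ℕ → EuclideanSpace ℝ ι} {j k : ι} {a b c : ℝ}
    (hj : Tendsto (fun n ↦ sampleMean z n j) atTop (𝓝 a))
    (hk : Tendsto (fun n ↦ sampleMean z n k) atTop (𝓝 b))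
    (hjk : Tendsto (fun n : ℕ ↦ (∑ i ∈ Finset.range n, z i j * z i k) / n) atTop (𝓝 c)) :
    Tendsto (fun n ↦ sampleCov z n j k) atTop (𝓝 (c - a * b)) := by
  have h1 : Tendsto (fun n : ℕ ↦ (n : ℝ) / ((n : ℝ) - 1)) atTop (𝓝 1) := by
    have := tendsto_natCast_div_add_atTop (𝕜 := ℝ) (-1)
    simpa [sub_eq_add_neg] using this
  have h := h1.mul (hjk.sub (hj.mul hk))
  rw [one_mul] at h
  refine h.congr' ?_
  filter_upwards [eventually_ne_atTop 0] with n hn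
  rw [sampleCov_apply z hn]

/-- If sample means and sample covariances converge, to `m` and `S + diagonal d`, then the Gaussian
plug-in estimate is eventually within every radius above `√(p c)` of the Gaussian law with mean `m`
and covariance `S`, where `c` bounds the entries of `d`. -/
theorem eventually_wasserstein_empiricalGaussian_le {z : ℕ → EuclideanSpace ℝ ι}
    {m : EuclideanSpace ℝ ι} {S : Matrix ι ι ℝ} (hS : S.PosSemidef) {d : ι → ℝ} {c r : ℝ}
    (hd : ∀ i, 0 ≤ d i) (hdc : ∀ i, d i ≤ c)
    (hm : ∀ j, Tendsto (fun n ↦ sampleMean z n j) atTop (𝓝 (m j)))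
    (hC : ∀ j k, Tendsto (fun n ↦ sampleCov z n j k) atTop (𝓝 ((S + diagonal d) j k)))
    (hr : 0 ≤ r) (hcr : Fintype.card ι * c < r ^ 2) :
    ∀ᶠ n in atTop, wasserstein 2 (empiricalGaussian z n) (multivariateGaussian m S) ≤
      ENNReal.ofReal r := by
  -- Splitting off `diagonal d` before the crude entrywise bound leaves a remainder that vanishes in
  -- the limit, so the sharp constant `c` survives.
  set κ : ℕ → ℝ := fun n ↦ c + ∑ j, ∑ k, |(sampleCov z n - S - diagonal d) j k| with hκ
  have hκt : Tendsto κ atTop (𝓝 c) := by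
    have h : Tendsto κ atTop (𝓝 (c + ∑ j : ι, ∑ k : ι, |(0 : ℝ)|)) := by
      refine tendsto_const_nhds.add (tendsto_finsetSum _ fun j _ ↦ tendsto_finsetSum _ fun k _ ↦ ?_)
      have := ((hC j k).sub_const ((S + diagonal d) j k)).abs
      rw [sub_self] at this
      refine this.congr fun n ↦ ?_
      simp [sub_sub]
    simpa using h
  have hmt : Tendsto (fun n ↦ ‖sampleMean z n - m‖ ^ 2) atTop (𝓝 0) := by
    have h : Tendsto (fun n ↦ ∑ j, (sampleMean z n j - m j) ^ 2) atTop
        (𝓝 (∑ j, (m j - m j) ^ 2)) :=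
      tendsto_finsetSum _ fun j _ ↦ ((hm j).sub_const _).pow 2
    simpa [EuclideanSpace.real_norm_sq_eq] using h
  have ht := hmt.add (hκt.const_mul (Fintype.card ι : ℝ))
  rw [zero_add] at ht
  filter_upwards [ht.eventually_lt_const hcr] with n hn
  refine (wasserstein_two_multivariateGaussian_le _ _ (sampleCov_posSemidef z n) hS
    fun v hv ↦ abs_dotProduct_mulVec_le hd hdc hv).trans ?_
  exact ENNReal.ofReal_le_ofReal ((Real.sqrt_le_left hr).2 hn.le)


/-! ### Moments of the noise and of the reported records. -/

section Noise

variable {px py : ℕ} {σ : ℝ}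

instance isProbabilityMeasure_noiseLaw : IsProbabilityMeasure (noiseLaw px σ) :=
  Measure.isProbabilityMeasure_map (by fun_prop)

lemma measurePreserving_eval_noiseLaw (i : Fin px) :
    MeasurePreserving (fun w ↦ w i) (noiseLaw px σ) (gaussianReal 0 (σ ^ 2).toNNReal) where
  measurable := by fun_prop
  map_eq := by
    rw [noiseLaw, Measure.map_map (by fun_prop) (by fun_prop)]
    exact (measurePreserving_eval (fun _ : Fin px ↦ gaussianReal 0 (σ ^ 2).toNNReal) i).map_eq

lemma covariance_eval_noiseLaw (i j : Fin px) :
    cov[fun w ↦ w i, fun w ↦ w j; noiseLaw px σ] = if i = j then σ ^ 2 else 0 := by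
  split_ifs with h
  · subst h
    rw [covariance_self (by fun_prop), (measurePreserving_eval_noiseLaw i).hasLaw.variance_eq,
      variance_id_gaussianReal, Real.coe_toNNReal _ (sq_nonneg σ)]
  · have hL (k : Fin px) : MemLp (fun x : Fin px → ℝ ↦ x k) 2
        (Measure.pi fun _ ↦ gaussianReal 0 (σ ^ 2).toNNReal) :=
      (memLp_id_gaussianReal 2).comp_measurePreserving (measurePreserving_eval _ k)
    rw [noiseLaw, covariance_map_fun (by fun_prop) (by fun_prop) (by fun_prop)]
    exact ((iIndepFun_pi (X := fun _ : Fin px ↦ (id : ℝ → ℝ))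
      fun _ ↦ aemeasurable_id).indepFun h).covariance_eq_zero (hL i) (hL j)

/-- The contribution of the noise to a coordinate of the reported record. -/
noncomputable def noiseCoord (px py : ℕ) (j : Fin px ⊕ Fin py) (w : EuclideanSpace ℝ (Fin px)) :
    ℝ :=
  Sum.elim (fun i ↦ w i) (fun _ ↦ 0) j

/-- The variance of the noise in a coordinate of the reported record. -/
noncomputable def noiseVar (px py : ℕ) (σ : ℝ) : Fin px ⊕ Fin py → ℝ :=
  Sum.elim (fun _ ↦ σ ^ 2) (fun _ ↦ 0)

lemma privatize_apply (x : Record px py) (w : EuclideanSpace ℝ (Fin px)) (j : Fin px ⊕ Fin py) :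
    privatize x w j = x j + noiseCoord px py j w := by
  rcases j with i | i <;> simp [privatize, noiseCoord]

lemma memLp_noiseCoord (j : Fin px ⊕ Fin py) : MemLp (noiseCoord px py j) 2 (noiseLaw px σ) := by
  rcases j with i | i
  · exact (memLp_id_gaussianReal 2).comp_measurePreserving (measurePreserving_eval_noiseLaw i)
  · exact memLp_const 0

lemma integral_noiseCoord (j : Fin px ⊕ Fin py) :
    ∫ w, noiseCoord px py j w ∂noiseLaw px σ = 0 := by
  rcases j with i | i
  · exact (measurePreserving_eval_noiseLaw i).hasLaw.integral_eq.trans integral_id_gaussianReal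
  · exact integral_zero _ _

lemma covariance_noiseCoord (j k : Fin px ⊕ Fin py) :
    cov[noiseCoord px py j, noiseCoord px py k; noiseLaw px σ] =
      diagonal (noiseVar px py σ) j k := by
  rcases j with i | i <;> rcases k with l | l
  · refine (covariance_eval_noiseLaw i l).trans ?_
    simp [diagonal_apply, noiseVar]
  · exact (covariance_const_right 0).trans (by simp)
  · exact (covariance_const_left 0).trans (by simp)
  · exact (covariance_const_left 0).trans (by simp [diagonal_apply, noiseVar])

variable {m : Record px py} {S : Matrix (Fin px ⊕ Fin py) (Fin px ⊕ Fin py) ℝ}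

lemma memLp_eval_multivariateGaussian (j : Fin px ⊕ Fin py) :
    MemLp (fun x : Record px py ↦ x j) 2 (multivariateGaussian m S) :=
  (EuclideanSpace.proj (𝕜 := ℝ) j).comp_memLp' IsGaussian.memLp_two_id

lemma memLp_privatize (j : Fin px ⊕ Fin py) :
    MemLp (fun q : Record px py × EuclideanSpace ℝ (Fin px) ↦ privatize q.1 q.2 j) 2
      ((multivariateGaussian m S).prod (noiseLaw px σ)) := by
  simp_rw [privatize_apply]
  exact ((memLp_eval_multivariateGaussian j).comp_fst _).add ((memLp_noiseCoord j).comp_snd _)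

lemma integral_privatize (j : Fin px ⊕ Fin py) :
    ∫ q, privatize q.1 q.2 j ∂((multivariateGaussian m S).prod (noiseLaw px σ)) = m j := by
  have hX := memLp_eval_multivariateGaussian (m := m) (S := S) j
  have h1 : ∫ x : Record px py, x j ∂multivariateGaussian m S = m j := by
    have := (EuclideanSpace.proj (𝕜 := ℝ) j).integral_comp_id_comm
      (IsGaussian.integrable_id (μ := multivariateGaussian m S))
    simpa using this
  simp_rw [privatize_apply]
  rw [integral_add ((hX.comp_fst (noiseLaw px σ)).integrable one_le_two)
    (((memLp_noiseCoord j).comp_snd _).integrable one_le_two),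
    integral_fun_fst (fun x : Record px py ↦ x j), integral_fun_snd (noiseCoord px py j),
    integral_noiseCoord, h1]
  simp

lemma covariance_privatize (hS : S.PosSemidef) (j k : Fin px ⊕ Fin py) :
    cov[fun q ↦ privatize q.1 q.2 j, fun q ↦ privatize q.1 q.2 k;
      (multivariateGaussian m S).prod (noiseLaw px σ)] =
      (S + diagonal (noiseVar px py σ)) j k := by
  set μ := multivariateGaussian m S with hμ
  set ν := noiseLaw px σ with hν
  have hX (j) : MemLp (fun x : Record px py ↦ x j) 2 μ := memLp_eval_multivariateGaussian j
  have hN (j) : MemLp (noiseCoord px py j) 2 ν := memLp_noiseCoord j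
  have hX' (j) := (hX j).comp_fst ν
  have hN' (j) := (hN j).comp_snd μ
  have e (j) : (fun q : Record px py × EuclideanSpace ℝ (Fin px) ↦ privatize q.1 q.2 j) =
      (fun q ↦ q.1 j) + fun q ↦ noiseCoord px py j q.2 := funext fun q ↦ privatize_apply _ _ _
  have hXX : cov[fun q ↦ q.1 j, fun q ↦ q.1 k; μ.prod ν] = S j k := by
    rw [← covariance_eval_multivariateGaussian (μ := m) hS j k]
    exact (measurePreserving_fst (μ := μ) (ν := ν)).hasLaw.covariance_fun_comp
      (hX j).aemeasurable (hX k).aemeasurable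
  have hNN : cov[fun q ↦ noiseCoord px py j q.2, fun q ↦ noiseCoord px py k q.2; μ.prod ν] =
      diagonal (noiseVar px py σ) j k := by
    rw [← covariance_noiseCoord]
    exact (measurePreserving_snd (μ := μ) (ν := ν)).hasLaw.covariance_fun_comp
      (hN j).aemeasurable (hN k).aemeasurable
  -- Record and noise are independent under the product law, so the cross terms vanish.
  rw [e j, e k, covariance_add_left (hX' j) (hN' j) ((hX' k).add (hN' k)),
    covariance_add_right (hX' j) (hX' k) (hN' k), covariance_add_right (hN' j) (hX' k) (hN' k),
    hXX, hNN, covariance_fst_snd_prod (hX j) (hN k), covariance_comm,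
    covariance_fst_snd_prod (hX k) (hN j)]
  simp

end Noise

/-! ### Almost sure convergence and conclusion. -/

/-- The strong law of large numbers for a function of i.i.d. random variables of given law. -/
lemma strong_law_ae_comp {Ω F : Type*} [MeasurableSpace Ω] [MeasurableSpace F] {Pr : Measure Ω}
    {μ : Measure F} {X : ℕ → Ω → F} (hlaw : ∀ i, HasLaw (X i) μ Pr) (hindep : iIndepFun X Pr)
    {f : F → ℝ} (hf : Measurable f) (hfi : Integrable f μ) :
    ∀ᵐ ω ∂Pr, Tendsto (fun n : ℕ ↦ (∑ i ∈ Finset.range n, f (X i ω)) / n) atTop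
      (𝓝 (∫ x, f x ∂μ)) := by
  rw [← (hlaw 0).integral_comp hfi.aestronglyMeasurable]
  refine strong_law_ae_real (fun i ↦ f ∘ X i) ?_
    (fun i j hij ↦ (hindep.indepFun hij).comp hf hf)
    fun i ↦ ((hlaw i).identDistrib (hlaw 0)).comp hf
  rw [← (hlaw 0).map_eq] at hfi
  exact hfi.comp_aemeasurable (hlaw 0).aemeasurable

/-- Almost surely, the sample means of the reported records converge to the true mean, and their
sample covariances converge to the sum of the true covariance and the covariance of the noise. -/
theorem ae_tendsto_sampleMean_sampleCov {px py : ℕ} {m : Record px py}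
    {S : Matrix (Fin px ⊕ Fin py) (Fin px ⊕ Fin py) ℝ} (hS : S.PosSemidef) {σ : ℝ}
    {Ω : Type*} [MeasurableSpace Ω] {Pr : Measure Ω}
    {ξ : ℕ → Ω → Record px py} {w : ℕ → Ω → EuclideanSpace ℝ (Fin px)}
    (hlaw : ∀ i, HasLaw (fun ω ↦ (ξ i ω, w i ω))
      ((multivariateGaussian m S).prod (noiseLaw px σ)) Pr)
    (hindep : iIndepFun (fun i ω ↦ (ξ i ω, w i ω)) Pr) :
    ∀ᵐ ω ∂Pr,
      (∀ j, Tendsto (fun n ↦ sampleMean (fun i ↦ privatize (ξ i ω) (w i ω)) n j) atTop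
        (𝓝 (m j))) ∧
      ∀ j k, Tendsto (fun n ↦ sampleCov (fun i ↦ privatize (ξ i ω) (w i ω)) n j k) atTop
        (𝓝 ((S + diagonal (noiseVar px py σ)) j k)) := by
  have hmeas (j) : Measurable
      fun q : Record px py × EuclideanSpace ℝ (Fin px) ↦ privatize q.1 q.2 j := by
    simp_rw [privatize_apply]
    rcases j with i | i <;> simp only [noiseCoord, Sum.elim_inl, Sum.elim_inr] <;> fun_prop
  have h1 (j) := strong_law_ae_comp hlaw hindep (hmeas j)
    ((memLp_privatize j).integrable one_le_two)
  -- Second moments suffice: a product of two square-integrable coordinates is integrable.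
  have h2 (j k) := strong_law_ae_comp hlaw hindep ((hmeas j).mul (hmeas k))
    ((memLp_privatize j).integrable_mul (memLp_privatize k))
  filter_upwards [ae_all_iff.2 h1, ae_all_iff.2 fun j ↦ ae_all_iff.2 (h2 j)] with ω hω1 hω2
  have hm (j) : Tendsto (fun n ↦ sampleMean (fun i ↦ privatize (ξ i ω) (w i ω)) n j) atTop
      (𝓝 (m j)) := by
    simp_rw [sampleMean_apply]
    simpa only [integral_privatize] using hω1 j
  refine ⟨hm, fun j k ↦ ?_⟩
  have h := tendsto_sampleCov (hm j) (hm k) (hω2 j k)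
  have hc := covariance_eq_sub (memLp_privatize (m := m) (S := S) (σ := σ) j)
    (memLp_privatize k)
  rw [covariance_privatize hS, integral_privatize, integral_privatize] at hc
  rw [hc]
  exact h

end DPGaussian

/-- Clean records `ξ i = (x i, y i)` are Gaussian with mean `m` and covariance `S`; the noise `w i`
of the Gaussian mechanism is independent of the record, and the pairs `(ξ i, w i)` are i.i.d.
The numbers `ε` and `δ` are the privacy parameters, `η` is the accuracy. -/
theorem mainTheorem6 (px py : ℕ)
    (m : DPGaussian.Record px py)
    (S : Matrix (Fin px ⊕ Fin py) (Fin px ⊕ Fin py) ℝ) (hS : S.PosSemidef)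
    (xlo xhi : ℝ) (hx : xlo ≤ xhi)
    (ε δ : ℝ) (hε : 0 < ε) (hδ : 0 < δ) (hδ' : δ ≤ 1.25)
    {Ω : Type*} [MeasurableSpace Ω] (Pr : Measure Ω) [IsProbabilityMeasure Pr]
    (ξ : ℕ → Ω → DPGaussian.Record px py) (w : ℕ → Ω → EuclideanSpace ℝ (Fin px))
    (hlaw : ∀ i, HasLaw (fun ω ↦ (ξ i ω, w i ω))
      ((multivariateGaussian m S).prod
        (DPGaussian.noiseLaw px
          (DPGaussian.noiseStd (DPGaussian.sensitivity px xlo xhi) ε δ))) Pr)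
    (hindep : iIndepFun (fun i ω ↦ (ξ i ω, w i ω)) Pr) :
    ∀ᵐ ω ∂Pr, ∀ η : ℝ, 0 < η → ∃ N : ℕ, ∀ n : ℕ, N ≤ n →
      DPGaussian.wasserstein 2
          (DPGaussian.empiricalGaussian (fun i ↦ DPGaussian.privatize (ξ i ω) (w i ω)) n)
          (multivariateGaussian m S) ≤
        ENNReal.ofReal (η + √(2 * Real.log (1.25 / δ) * ((px : ℝ) + (py : ℝ))) *
          DPGaussian.sensitivity px xlo xhi / ε) := by
  set σ := DPGaussian.noiseStd (DPGaussian.sensitivity px xlo xhi) ε δ with hσ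
  have hs : 0 ≤ DPGaussian.sensitivity px xlo xhi :=
    mul_nonneg (sub_nonneg.2 hx) (Nat.cast_nonneg px)
  have hσ0 : 0 ≤ σ := by
    rw [hσ, DPGaussian.noiseStd]
    positivity
  have hlog : 0 ≤ 2 * Real.log (1.25 / δ) :=
    mul_nonneg zero_le_two (Real.log_nonneg ((one_le_div hδ).2 hδ'))
  have hr : √(2 * Real.log (1.25 / δ) * ((px : ℝ) + (py : ℝ))) *
      DPGaussian.sensitivity px xlo xhi / ε = √((px : ℝ) + py) * σ := by
    rw [hσ, DPGaussian.noiseStd, Real.sqrt_mul hlog]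
    ring
  -- The almost sure event is convergence of the moments, so it does not depend on `η`.
  filter_upwards [DPGaussian.ae_tendsto_sampleMean_sampleCov hS hlaw hindep] with ω hω η hη
  rw [hr, ← Filter.eventually_atTop]
  -- `σ ^ 2` also bounds the zero noise variance of the output coordinates; hence `px + py` in the
  -- radius.
  refine DPGaussian.eventually_wasserstein_empiricalGaussian_le hS (c := σ ^ 2) ?_ ?_ hω.1 hω.2
    (by positivity) ?_
  · rintro (i | i)
    · exact sq_nonneg σ
    · exact le_rfl
  · rintro (i | i)
    · exact le_rfl
    · exact sq_nonneg σ
  · have hp : √((px : ℝ) + py) ^ 2 = (px : ℝ) + py := Real.sq_sqrt (by positivity)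
    have h0 : 0 ≤ √((px : ℝ) + py) * σ := by positivity
    simp only [Fintype.card_sum, Fintype.card_fin, Nat.cast_add]
    calc _ = (√((px : ℝ) + py) * σ) ^ 2 := by rw [mul_pow, hp]
      _ < _ := pow_lt_pow_left₀ (lt_add_of_pos_left _ hη) h0 two_ne_zero
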